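/- Let $\mathcal M$ be one of $\mathbb R^3$, $\mathbb S^3$, $\mathbb H^3$ (curvature $0$, $1$, $-1$), let $I\subset\mathbb R$ be a nonempty open interval, and let $\gamma:I\to\mathcal M$ be a smooth curve parametrized by arc length (not necessarily injective, so that closed curves, viewed as periodic curves on $I=\mathbb R$, are included), with a smooth orthonormal frame $T=\dot\gamma$, $N$, $B$ of $T\mathcal M$ along $\gamma$ satisfying the Frenet–Serret equations $$\frac{DT}{ds}=k_1N,\qquad \frac{DN}{ds}=-k_1T+k_2B,\qquad \frac{DB}{ds}=-k_2N,$$ where the curvature scalars $k_1,k_2$ are constant on $I$. Let $\psi\mapsto(f(\psi),g(\psi))$ be a smooth $2\pi$-periodic simple closed plane curve, let $\rho_0>0$, and consider the generalized tube $\Sigma$ parametrized by $$\beta(s,\psi)=\exp_{\gamma(s)}\bigl(\rho_0f(\psi)N(s)+\rho_0g(\psi)B(s)\bigr),\qquad s\in I,\ \psi\in\mathbb R .$$ Assume that the tube is a regular surface, i.e. that $\partial_s\beta$ and $\partial_\psi\beta$ are linearly independent at every $(s,\psi)$. Let $H(s,\psi,p_s,p_\psi)=\tfrac12 g^{ij}p_ip_j$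 be the Hamiltonian of the geodesic flow of the metric $g_{ij}=\langle\partial_i\beta,\partial_j\beta\rangle$ induced on $\Sigma$. Then $s$ is an ignorable coordinate, i.e. $H$ does not depend on $s$, and the geodesic flow of $\Sigma$ is Liouville integrable: there are two functions $\Phi_1,\Phi_2$ on the cotangent bundle $T^*\Sigma$ that are smooth (as functions of $(s,\psi,p_s,p_\psi)$), are first integrals, $\{\Phi_k,H\}=0$, are in involution, $\{\Phi_1,\Phi_2\}=0$, and are functionally independent almost everywhere, i.e. $d\Phi_1,d\Phi_2$ are linearly independent outside a set of measure zero in the phase space (in particular on an open dense set). -/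

import Mathlib

open scoped ContDiff Matrix

/-- The three simply connected three-dimensional space forms `ℝ³`, `𝕊³`, `ℍ³`. -/
inductive SpaceForm where
  | euclidean
  | spherical
  | hyperbolic

namespace SpaceForm

/-- Dimension of the ambient vector space: `ℝ³` is itself, `𝕊³` is the unit sphere of `ℝ⁴`,
`ℍ³` is the upper sheet of the hyperboloid in `ℝ⁴` with the Minkowski form. -/
abbrev dim : SpaceForm → ℕ
  | euclidean => 3
  | spherical => 4
  | hyperbolic => 4

/-- The ambient vector space of the model. -/
abbrev Ambient (M : SpaceForm) : Type := EuclideanSpace ℝ (Fin M.dim)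

/-- The ambient bilinear form: the Euclidean inner product for `ℝ³` and `𝕊³`, the Minkowski form
`-x₀y₀ + x₁y₁ + x₂y₂ + x₃y₃` for `ℍ³`. The Riemannian metric of `M` is its restriction to the
tangent spaces. -/
noncomputable def form : (M : SpaceForm) → M.Ambient → M.Ambient → ℝ
  | euclidean, x, y => inner ℝ x y
  | spherical, x, y => inner ℝ x y
  | hyperbolic, x, y =>
      -(x (0 : Fin 4) * y (0 : Fin 4)) + x (1 : Fin 4) * y (1 : Fin 4)
        + x (2 : Fin 4) * y (2 : Fin 4) + x (3 : Fin 4) * y (3 : Fin 4)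

/-- The points of the space form, as a subset of the ambient space. -/
def carrier : (M : SpaceForm) → Set M.Ambient
  | euclidean => Set.univ
  | spherical => {x | form spherical x x = 1}
  | hyperbolic => {x | form hyperbolic x x = -1 ∧ 0 < x (0 : Fin 4)}

/-- The tangent space `T_p M`, as a subset of the ambient space. -/
def tangent : (M : SpaceForm) → M.Ambient → Set M.Ambient
  | euclidean, _ => Set.univ
  | spherical, p => {v | form spherical p v = 0}
  | hyperbolic, p => {v | form hyperbolic p v = 0}

/-- The sectional curvature `0`, `1`, `-1`. -/
def curvature : SpaceForm → ℝ
  | euclidean => 0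
  | spherical => 1
  | hyperbolic => -1

/-- The covariant derivative `DX/ds` (Levi-Civita connection of `M`) of a vector field `X` along a
curve `c` in `M`: the tangential part of the ambient derivative `X'`. For `𝕊³` and `ℍ³` one has
`⟨c, c⟩ = K = ±1`, so that the part of `X'` normal to `M` is `K ⟨X', c⟩ c`. -/
noncomputable def covDeriv (M : SpaceForm) (c X : ℝ → M.Ambient) (s : ℝ) : M.Ambient :=
  deriv X s - (M.curvature * M.form (deriv X s) (c s)) • c s

/-- Geodesics of `M`, defined for all times: smooth curves with `D c' / dt = 0`. -/
structure IsGeodesic (M : SpaceForm) (c : ℝ → M.Ambient) : Prop where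
  smooth : ContDiff ℝ ∞ c
  mem : ∀ t, c t ∈ M.carrier
  acc : ∀ t, M.covDeriv c (deriv c) t = 0

/-- The length `‖v‖` of a tangent vector. -/
noncomputable def len (M : SpaceForm) (v : M.Ambient) : ℝ := Real.sqrt (M.form v v)

/-- The generalized cosine `1`, `cos r`, `cosh r` of curvature `0`, `1`, `-1`. -/
noncomputable def gcos : SpaceForm → ℝ → ℝ
  | euclidean, _ => 1
  | spherical, r => Real.cos r
  | hyperbolic, r => Real.cosh r

/-- The generalized sine `r`, `sin r`, `sinh r` of curvature `0`, `1`, `-1`. -/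
noncomputable def gsin : SpaceForm → ℝ → ℝ
  | euclidean, r => r
  | spherical, r => Real.sin r
  | hyperbolic, r => Real.sinh r

/-- The Riemannian exponential map `exp_p v`, for `p ∈ M` and `v ∈ T_p M`:
`p + v` in `ℝ³`, `cos ‖v‖ p + (sin ‖v‖ / ‖v‖) v` in `𝕊³`, `cosh ‖v‖ p + (sinh ‖v‖ / ‖v‖) v` in `ℍ³`.
That `t ↦ exp_p (t v)` is the geodesic with initial point `p` and initial velocity `v` is proved in
`SpaceForm.expMap_isGeodesic` and `SpaceForm.expMap_initial` below. If `‖v‖ = 0`, then `v = 0`, so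
the value of the coefficient of `v` does not matter in that case. -/
noncomputable def expMap (M : SpaceForm) (p v : M.Ambient) : M.Ambient :=
  M.gcos (M.len v) • p + (M.gsin (M.len v) / M.len v) • v

/-- In `ℝ³` the exponential map is addition. -/
theorem expMap_euclidean (p v : Ambient euclidean) : expMap euclidean p v = p + v := by
  by_cases h : len euclidean v = 0
  · have h1 : (inner ℝ v v : ℝ) = 0 := (Real.sqrt_eq_zero real_inner_self_nonneg).1 h
    have h2 : v = 0 := inner_self_eq_zero.1 h1
    simp [expMap, gcos, h2]
  · simp [expMap, gcos, gsin, h]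

theorem form_comm (M : SpaceForm) (x y : M.Ambient) : M.form x y = M.form y x := by
  cases M
  · exact real_inner_comm _ _
  · exact real_inner_comm _ _
  · simp only [form]; ring

theorem form_add_left (M : SpaceForm) (x y z : M.Ambient) :
    M.form (x + y) z = M.form x z + M.form y z := by
  cases M
  · exact inner_add_left _ _ _
  · exact inner_add_left _ _ _
  · simp only [form, PiLp.add_apply]; ring

theorem form_smul_left (M : SpaceForm) (a : ℝ) (x y : M.Ambient) :
    M.form (a • x) y = a * M.form x y := by
  cases M
  · exact real_inner_smul_left _ _ _
  · exact real_inner_smul_left _ _ _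
  · simp only [form, PiLp.smul_apply, smul_eq_mul]; ring

theorem form_add_right (M : SpaceForm) (x y z : M.Ambient) :
    M.form x (y + z) = M.form x y + M.form x z := by
  rw [form_comm, form_add_left, form_comm M y, form_comm M z]

theorem form_smul_right (M : SpaceForm) (a : ℝ) (x y : M.Ambient) :
    M.form x (a • y) = a * M.form x y := by
  rw [form_comm, form_smul_left, form_comm M y]

/-- Auxiliary bound for tangent vectors of the hyperboloid. -/
theorem hyperbolic_bound {p v : Ambient hyperbolic} (hp : p ∈ carrier hyperbolic)
    (hv : v ∈ tangent hyperbolic p) :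
    v (0 : Fin 4) ^ 2 + v (1 : Fin 4) ^ 2 + v (2 : Fin 4) ^ 2 + v (3 : Fin 4) ^ 2
        - v (0 : Fin 4) ^ 2
      ≤ p (0 : Fin 4) ^ 2 * form hyperbolic v v := by
  obtain ⟨h1, -⟩ := hp
  have h2 : form hyperbolic p v = 0 := hv
  simp only [form] at h1 h2 ⊢
  generalize p (0 : Fin 4) = a at *
  generalize p (1 : Fin 4) = b at *
  generalize p (2 : Fin 4) = c at *
  generalize p (3 : Fin 4) = d at *
  generalize v (0 : Fin 4) = x at *
  generalize v (1 : Fin 4) = y at *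
  generalize v (2 : Fin 4) = z at *
  generalize v (3 : Fin 4) = w at *
  have e1 : a ^ 2 = 1 + b ^ 2 + c ^ 2 + d ^ 2 := by linarith
  have e2 : a * x = b * y + c * z + d * w := by linarith
  have e3 : a ^ 2 * x ^ 2 = (b * y + c * z + d * w) ^ 2 := by rw [← e2]; ring
  have e4 : a ^ 2 * (-(x * x) + y * y + z * z + w * w)
      = (1 + b ^ 2 + c ^ 2 + d ^ 2) * (y ^ 2 + z ^ 2 + w ^ 2)
        - (b * y + c * z + d * w) ^ 2 := by
    rw [← e3, ← e1]; ring
  rw [e4]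
  nlinarith [sq_nonneg (b * z - c * y), sq_nonneg (b * w - d * y), sq_nonneg (c * w - d * z)]

/-- The metric is positive semidefinite on tangent spaces. -/
theorem form_self_nonneg (M : SpaceForm) {p v : M.Ambient} (hp : p ∈ M.carrier)
    (hv : v ∈ M.tangent p) : 0 ≤ M.form v v := by
  cases M
  · exact real_inner_self_nonneg
  · exact real_inner_self_nonneg
  · have h := hyperbolic_bound hp hv
    have hp0 : (0 : ℝ) < p (0 : Fin 4) ^ 2 := pow_pos hp.2 2
    by_contra hn
    push Not at hn
    nlinarith [sq_nonneg (v (1 : Fin 4)), sq_nonneg (v (2 : Fin 4)), sq_nonneg (v (3 : Fin 4)),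
      mul_neg_of_pos_of_neg hp0 hn]

/-- The metric is definite on tangent spaces. -/
theorem eq_zero_of_form_self (M : SpaceForm) {p v : M.Ambient} (hp : p ∈ M.carrier)
    (hv : v ∈ M.tangent p) (h0 : M.form v v = 0) : v = 0 := by
  cases M
  · exact inner_self_eq_zero.1 h0
  · exact inner_self_eq_zero.1 h0
  · have h := hyperbolic_bound hp hv
    rw [h0, mul_zero] at h
    have h1 : v (1 : Fin 4) = 0 := by
      nlinarith [sq_nonneg (v (1 : Fin 4)), sq_nonneg (v (2 : Fin 4)), sq_nonneg (v (3 : Fin 4))]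
    have h2 : v (2 : Fin 4) = 0 := by
      nlinarith [sq_nonneg (v (1 : Fin 4)), sq_nonneg (v (2 : Fin 4)), sq_nonneg (v (3 : Fin 4))]
    have h3 : v (3 : Fin 4) = 0 := by
      nlinarith [sq_nonneg (v (1 : Fin 4)), sq_nonneg (v (2 : Fin 4)), sq_nonneg (v (3 : Fin 4))]
    have hx : v (0 : Fin 4) = 0 := by
      simp only [form, h1, h2, h3] at h0
      nlinarith
    ext i
    change Fin 4 at i
    fin_cases i
    · exact hx
    · exact h1
    · exact h2
    · exact h3

theorem len_smul (M : SpaceForm) (t : ℝ) (v : M.Ambient) : M.len (t • v) = |t| * M.len v := by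
  rw [len, len, form_smul_left, form_smul_right, ← mul_assoc, ← sq, Real.sqrt_mul (sq_nonneg t),
    Real.sqrt_sq_eq_abs]

theorem sq_len (M : SpaceForm) {p v : M.Ambient} (hp : p ∈ M.carrier) (hv : v ∈ M.tangent p) :
    M.len v * M.len v = M.form v v :=
  Real.mul_self_sqrt (M.form_self_nonneg hp hv)

theorem gcos_neg (M : SpaceForm) (r : ℝ) : M.gcos (-r) = M.gcos r := by
  cases M
  · rfl
  · exact Real.cos_neg r
  · exact Real.cosh_neg r

theorem gsin_neg (M : SpaceForm) (r : ℝ) : M.gsin (-r) = -M.gsin r := by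
  cases M
  · rfl
  · exact Real.sin_neg r
  · exact Real.sinh_neg r

theorem gcos_zero (M : SpaceForm) : M.gcos 0 = 1 := by
  cases M
  · rfl
  · exact Real.cos_zero
  · exact Real.cosh_zero

theorem gsin_zero (M : SpaceForm) : M.gsin 0 = 0 := by
  cases M
  · rfl
  · exact Real.sin_zero
  · exact Real.sinh_zero

theorem contDiff_gcos (M : SpaceForm) : ContDiff ℝ ∞ M.gcos := by
  cases M
  · exact contDiff_const
  · exact Real.contDiff_cos
  · exact Real.contDiff_cosh

theorem contDiff_gsin (M : SpaceForm) : ContDiff ℝ ∞ M.gsin := by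
  cases M
  · exact contDiff_id
  · exact Real.contDiff_sin
  · exact Real.contDiff_sinh

theorem hasDerivAt_gcos (M : SpaceForm) (r : ℝ) :
    HasDerivAt M.gcos (-(M.curvature * M.gsin r)) r := by
  cases M
  · refine (hasDerivAt_const r (1 : ℝ)).congr_deriv ?_
    simp [curvature]
  · refine (Real.hasDerivAt_cos r).congr_deriv ?_
    simp [curvature, gsin]
  · refine (Real.hasDerivAt_cosh r).congr_deriv ?_
    simp [curvature, gsin]

theorem hasDerivAt_gsin (M : SpaceForm) (r : ℝ) : HasDerivAt M.gsin (M.gcos r) r := by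
  cases M
  · exact hasDerivAt_id r
  · exact Real.hasDerivAt_sin r
  · exact Real.hasDerivAt_sinh r

/-- The exponential map along a ray. -/
theorem expMap_ray (M : SpaceForm) (p v : M.Ambient) (t : ℝ) :
    M.expMap p (t • v) = M.gcos (t * M.len v) • p + (M.gsin (t * M.len v) / M.len v) • v := by
  rw [expMap, len_smul, smul_smul]
  congr 2
  · rcases abs_choice t with h | h <;> rw [h]
    rw [neg_mul, gcos_neg]
  · by_cases hl : M.len v = 0
    · simp [hl]
    by_cases ht : t = 0
    · simp [ht, gsin_zero]
    rcases abs_choice t with h | h <;> rw [h]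
    · field_simp
    · rw [neg_mul, gsin_neg]; field_simp

/-- The velocity of `t ↦ exp_p (t v)`. -/
theorem deriv_expMap_ray (M : SpaceForm) {p v : M.Ambient} (hp : p ∈ M.carrier)
    (hv : v ∈ M.tangent p) :
    deriv (fun t : ℝ => M.expMap p (t • v)) = fun t =>
      (-(M.len v * (M.curvature * M.gsin (t * M.len v)))) • p + M.gcos (t * M.len v) • v := by
  funext t
  simp only [expMap_ray]
  by_cases hl : M.len v = 0
  · have : v = 0 := M.eq_zero_of_form_self hp hv (by rw [← M.sq_len hp hv, hl, mul_zero])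
    simp only [hl]
    simp [this]
  have hm : HasDerivAt (fun t : ℝ => t * M.len v) (M.len v) t := by
    simpa using (hasDerivAt_id t).mul_const (M.len v)
  have h := (((M.hasDerivAt_gcos _).comp t hm).smul_const p).add
    ((((M.hasDerivAt_gsin _).comp t hm).div_const (M.len v)).smul_const v)
  refine (h.deriv).trans ?_
  congr 2
  · ring
  · field_simp

/-- The acceleration of `t ↦ exp_p (t v)`. -/
theorem deriv_deriv_expMap_ray (M : SpaceForm) {p v : M.Ambient} (hp : p ∈ M.carrier)
    (hv : v ∈ M.tangent p) (t : ℝ) :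
    deriv (deriv (fun t : ℝ => M.expMap p (t • v))) t
      = (-(M.curvature * (M.len v * M.len v))) • M.expMap p (t • v) := by
  rw [deriv_expMap_ray M hp hv, expMap_ray]
  by_cases hl : M.len v = 0
  · have : v = 0 := M.eq_zero_of_form_self hp hv (by rw [← M.sq_len hp hv, hl, mul_zero])
    simp only [hl]
    simp [this]
  have hm : HasDerivAt (fun t : ℝ => t * M.len v) (M.len v) t := by
    simpa using (hasDerivAt_id t).mul_const (M.len v)
  have h := (((((M.hasDerivAt_gsin _).comp t hm).const_mul M.curvature).const_mul
    (M.len v)).neg.smul_const p).add (((M.hasDerivAt_gcos _).comp t hm).smul_const v)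
  refine (h.deriv).trans ?_
  rw [smul_add, smul_smul, smul_smul]
  congr 2
  · ring
  · field_simp

/-- For `p ∈ M` and `v ∈ T_p M` the curve `t ↦ exp_p (t v)` starts at `p` with velocity `v`. -/
theorem expMap_initial (M : SpaceForm) {p v : M.Ambient} (hp : p ∈ M.carrier)
    (hv : v ∈ M.tangent p) :
    M.expMap p ((0 : ℝ) • v) = p ∧ deriv (fun t : ℝ => M.expMap p (t • v)) 0 = v := by
  rw [M.deriv_expMap_ray hp hv, expMap_ray]
  simp [gcos_zero, gsin_zero]

theorem form_expMap_self (M : SpaceForm) {p v : M.Ambient} (h : M.form p v = 0) :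
    M.form (M.expMap p v) (M.expMap p v) = M.gcos (M.len v) ^ 2 * M.form p p
      + (M.gsin (M.len v) / M.len v) ^ 2 * M.form v v := by
  have h' : M.form v p = 0 := by rw [form_comm]; exact h
  rw [expMap]
  simp only [form_add_left, form_add_right, form_smul_left, form_smul_right, h, h']
  ring

/-- The exponential map takes values in `M`. -/
theorem expMap_mem (M : SpaceForm) {p v : M.Ambient} (hp : p ∈ M.carrier)
    (hv : v ∈ M.tangent p) : M.expMap p v ∈ M.carrier := by
  have hl := M.sq_len hp hv
  by_cases h0 : M.len v = 0
  · have hv0 : v = 0 := M.eq_zero_of_form_self hp hv (by rw [← hl, h0, mul_zero])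
    rw [expMap, h0, hv0, gcos_zero]
    simpa using hp
  cases M
  · trivial
  · have hpp : form spherical p p = 1 := hp
    have hpv : form spherical p v = 0 := hv
    change form spherical _ _ = 1
    rw [form_expMap_self _ hpv, hpp, ← hl]
    simp only [gcos, gsin]
    field_simp
    linarith [Real.sin_sq_add_cos_sq (len spherical v)]
  · have hpp : form hyperbolic p p = -1 := hp.1
    have hpv : form hyperbolic p v = 0 := hv
    refine ⟨?_, ?_⟩
    · rw [form_expMap_self _ hpv, hpp, ← hl]
      simp only [gcos, gsin]
      field_simp
      linarith [Real.cosh_sq (len hyperbolic v)]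
    · have hb := hyperbolic_bound hp hv
      have hp0 : 0 < p (0 : Fin 4) := hp.2
      have hr : 0 < len hyperbolic v := lt_of_le_of_ne (Real.sqrt_nonneg _) (Ne.symm h0)
      have hvv : form hyperbolic v v = v (1 : Fin 4) ^ 2 + v (2 : Fin 4) ^ 2 + v (3 : Fin 4) ^ 2
          - v (0 : Fin 4) ^ 2 := by simp only [form]; ring
      have hlt : |v (0 : Fin 4)| < len hyperbolic v * p (0 : Fin 4) := by
        apply abs_lt_of_sq_lt_sq _ (by positivity)
        nlinarith [mul_pos hr hr]
      have hs : |Real.sinh (len hyperbolic v)| < Real.cosh (len hyperbolic v) := by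
        apply abs_lt_of_sq_lt_sq _ (Real.cosh_pos _).le
        linarith [Real.cosh_sq (len hyperbolic v)]
      have hprod : |Real.sinh (len hyperbolic v) * v (0 : Fin 4)|
          < Real.cosh (len hyperbolic v) * (len hyperbolic v * p (0 : Fin 4)) := by
        rw [abs_mul]
        exact mul_lt_mul'' hs hlt (abs_nonneg _) (abs_nonneg _)
      have h3 := (abs_lt.1 hprod).1
      have h4 : expMap hyperbolic p v (0 : Fin 4)
          = (Real.cosh (len hyperbolic v) * (len hyperbolic v * p (0 : Fin 4))
            + Real.sinh (len hyperbolic v) * v (0 : Fin 4)) / len hyperbolic v := by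
        change Real.cosh (len hyperbolic v) * p (0 : Fin 4)
          + Real.sinh (len hyperbolic v) / len hyperbolic v * v (0 : Fin 4) = _
        field_simp
      rw [h4]
      exact div_pos (by linarith) hr

/-- For `p ∈ M` and `v ∈ T_p M` the curve `t ↦ exp_p (t v)` is a geodesic of `M`. -/
theorem expMap_isGeodesic (M : SpaceForm) {p v : M.Ambient} (hp : p ∈ M.carrier)
    (hv : v ∈ M.tangent p) : M.IsGeodesic (fun t : ℝ => M.expMap p (t • v)) := by
  have hc (t : ℝ) : M.expMap p (t • v) ∈ M.carrier := by
    refine M.expMap_mem hp ?_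
    cases M
    · trivial
    · change form spherical p (t • v) = 0
      have h : form spherical p v = 0 := hv
      rw [form_smul_right, h, mul_zero]
    · change form hyperbolic p (t • v) = 0
      have h : form hyperbolic p v = 0 := hv
      rw [form_smul_right, h, mul_zero]
  refine ⟨?_, hc, fun t => ?_⟩
  · simp only [expMap_ray]
    have h1 : ContDiff ℝ ∞ fun t : ℝ => t * M.len v := contDiff_id.mul contDiff_const
    exact ((M.contDiff_gcos.comp h1).smul contDiff_const).add
      (((M.contDiff_gsin.comp h1).div_const _).smul contDiff_const)
  · rw [covDeriv, M.deriv_deriv_expMap_ray hp hv, form_smul_left]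
    cases M
    · simp [curvature]
    · have h : form spherical _ _ = 1 := hc t
      rw [h]
      simp [curvature]
    · have h : form hyperbolic _ _ = -1 := (hc t).1
      rw [h]
      simp [curvature]

/-- An arc-length parametrized smooth curve `γ` in `M` over the open interval `I`, with a smooth
orthonormal frame `T = γ'`, `N`, `B` of `M` along `γ` satisfying the Frenet-Serret equations with
curvature scalars `k₁`, `k₂`. -/
structure IsFrenetCurve (M : SpaceForm) (I : Set ℝ) (γ T N B : ℝ → M.Ambient) (k₁ k₂ : ℝ → ℝ) :
    Prop where
  smooth_curve : ContDiffOn ℝ ∞ γ I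
  smooth_N : ContDiffOn ℝ ∞ N I
  smooth_B : ContDiffOn ℝ ∞ B I
  mem : ∀ s ∈ I, γ s ∈ M.carrier
  velocity : ∀ s ∈ I, T s = deriv γ s
  tangent_N : ∀ s ∈ I, N s ∈ M.tangent (γ s)
  tangent_B : ∀ s ∈ I, B s ∈ M.tangent (γ s)
  unit_T : ∀ s ∈ I, M.form (T s) (T s) = 1
  unit_N : ∀ s ∈ I, M.form (N s) (N s) = 1
  unit_B : ∀ s ∈ I, M.form (B s) (B s) = 1
  orth_TN : ∀ s ∈ I, M.form (T s) (N s) = 0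
  orth_TB : ∀ s ∈ I, M.form (T s) (B s) = 0
  orth_NB : ∀ s ∈ I, M.form (N s) (B s) = 0
  frenet_T : ∀ s ∈ I, M.covDeriv γ T s = k₁ s • N s
  frenet_N : ∀ s ∈ I, M.covDeriv γ N s = -(k₁ s • T s) + k₂ s • B s
  frenet_B : ∀ s ∈ I, M.covDeriv γ B s = -(k₂ s • N s)

/-- The parametrization
`β(s, ψ) = exp_{γ(s)} (ρ₀ f(ψ) N(s) + ρ₀ g(ψ) B(s))` of the generalized tube. The coordinates are
`q 0 = s` and `q 1 = ψ`. -/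
noncomputable def generalizedTube (M : SpaceForm) (γ N B : ℝ → M.Ambient) (f g : ℝ → ℝ) (ρ₀ : ℝ)
    (q : Fin 2 → ℝ) : M.Ambient :=
  M.expMap (γ (q 0)) ((ρ₀ * f (q 1)) • N (q 0) + (ρ₀ * g (q 1)) • B (q 0))

/-! ### The geodesic flow of a parametrized submanifold -/

/-- The coordinate vector field `∂_i β`. -/
noncomputable def partialDeriv (M : SpaceForm) {n : ℕ} (β : (Fin n → ℝ) → M.Ambient) (i : Fin n)
    (q : Fin n → ℝ) : M.Ambient :=
  fderiv ℝ β q (Pi.single i 1)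

/-- The induced metric (first fundamental form) `g_ij = ⟨∂_i β, ∂_j β⟩`. -/
noncomputable def inducedMetric (M : SpaceForm) {n : ℕ} (β : (Fin n → ℝ) → M.Ambient)
    (q : Fin n → ℝ) : Matrix (Fin n) (Fin n) ℝ :=
  Matrix.of fun i j => M.form (M.partialDeriv β i q) (M.partialDeriv β j q)

/-- The Hamiltonian `H(q, p) = ½ g^ij(q) p_i p_j` of the geodesic flow of the submanifold, in the
canonical coordinates `(q, p)` of its cotangent bundle. -/
noncomputable def hamiltonian (M : SpaceForm) {n : ℕ} (β : (Fin n → ℝ) → M.Ambient)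
    (x : (Fin n → ℝ) × (Fin n → ℝ)) : ℝ :=
  1 / 2 * (x.2 ⬝ᵥ ((M.inducedMetric β x.1)⁻¹ *ᵥ x.2))

/-- The map from canonical coordinates `(q, p)` to the cotangent bundle `T*Σ` of the submanifold `Σ`
parametrized by `β`. A covector at `x ∈ Σ` is represented by the pair `(x, v)`, where `v ∈ T_x Σ` is
its metric dual: `(q, p)` goes to the point `β(q)` and the vector `g^ij p_j ∂_i β`. -/
noncomputable def cotangentMap (M : SpaceForm) {n : ℕ} (β : (Fin n → ℝ) → M.Ambient)
    (x : (Fin n → ℝ) × (Fin n → ℝ)) : M.Ambient × M.Ambient :=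
  (β x.1, ∑ i, ((M.inducedMetric β x.1)⁻¹ *ᵥ x.2) i • M.partialDeriv β i x.1)

end SpaceForm

/-- The canonical Poisson bracket `{F, G} = ∑ i, ∂F/∂q_i ∂G/∂p_i - ∂F/∂p_i ∂G/∂q_i`. -/
noncomputable def poissonBracket {n : ℕ} (F G : (Fin n → ℝ) × (Fin n → ℝ) → ℝ)
    (x : (Fin n → ℝ) × (Fin n → ℝ)) : ℝ :=
  ∑ i, (fderiv ℝ F x (Pi.single i 1, 0) * fderiv ℝ G x (0, Pi.single i 1)
    - fderiv ℝ F x (0, Pi.single i 1) * fderiv ℝ G x (Pi.single i 1, 0))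

/-- Liouville integrability of the geodesic flow of the `n`-dimensional immersed submanifold `Σ` of
`M` parametrized by `β` on the open set `U`: there are `n` functions `Φ 0, …, Φ (n - 1)` on `T*Σ`
(each covector being represented by its base point and its metric dual, so that the `Φ k` are
functions on the cotangent bundle of `Σ` and not merely of the parameter domain; their
values off `T*Σ` are irrelevant), which are smooth, are first integrals of the Hamiltonian
flow, are pairwise in involution, and are functionally independent almost everywhere
(in particular on an open dense set). -/
def SpaceForm.LiouvilleIntegrable (M : SpaceForm) {n : ℕ} (U : Set (Fin n → ℝ))
    (β : (Fin n → ℝ) → M.Ambient) : Prop :=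
  ∃ Φ : Fin n → M.Ambient × M.Ambient → ℝ,
    (∀ k, ContDiffOn ℝ ∞ (Φ k ∘ M.cotangentMap β) (U ×ˢ Set.univ)) ∧
    (∀ k, ∀ x ∈ U ×ˢ Set.univ,
      poissonBracket (Φ k ∘ M.cotangentMap β) (M.hamiltonian β) x = 0) ∧
    (∀ k l, ∀ x ∈ U ×ˢ Set.univ,
      poissonBracket (Φ k ∘ M.cotangentMap β) (Φ l ∘ M.cotangentMap β) x = 0) ∧
    ∀ᵐ x, x ∈ U ×ˢ (Set.univ : Set (Fin n → ℝ)) →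
      LinearIndependent ℝ fun k => fderiv ℝ (Φ k ∘ M.cotangentMap β) x

/-- `ψ ↦ (f ψ, g ψ)` is a smooth simple closed plane curve, parametrized with period `2π`. -/
structure IsSimpleClosedPlaneCurve (f g : ℝ → ℝ) : Prop where
  smooth_f : ContDiff ℝ ∞ f
  smooth_g : ContDiff ℝ ∞ g
  periodic_f : Function.Periodic f (2 * Real.pi)
  periodic_g : Function.Periodic g (2 * Real.pi)
  simple : Set.InjOn (fun ψ => (f ψ, g ψ)) (Set.Ico 0 (2 * Real.pi))

/-!
The curvature scalars are constant, so the curve `γ` and its Frenet frame are carried along by a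
one-parameter group of isometries of `M`. Its generator is the ambient vector field `frenetField`,
built from the frame at one parameter `s`; it does not depend on `s`
(`SpaceForm.IsFrenetCurve.frenetField_eq`), since its derivative in `s` vanishes by the skewness of
the Frenet-Serret matrix. The isometries preserve the tube, and the field restricts to `∂_s β` on
it. Hence the induced metric depends on `ψ` only, and Clairaut's integral `p_s = ⟨X, v⟩`, with `X`
the Killing field and `v` the vector dual to the covector, is a function on the cotangent bundle
itself, even where the parametrization is not injective. The two integrals are `H = ½ ⟨v, v⟩` and
`p_s`; their differentials are independent wherever `∂H/∂p_ψ ≠ 0`, which fails only on a line of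
covectors over each point (`ae_mul_momentum_ne`).

Smoothness needs care where the profile curve passes through the origin, since the norm in
`exp_p v` is not smooth at `v = 0`. There the exponential map is written with the entire functions
`cosSeries` and `sinSeries` of `⟨v, v⟩`. All three geometries are treated at once: in each of them
`K ⟨γ, γ⟩ = K²` and `K ⟨γ, X⟩ = 0` for tangent `X`, and where `K = 0` the coefficient of `γ` in the
tube is constant.
-/

/-! ### Smoothness of the exponential map at zero vectors -/

/-- A power series whose coefficients are dominated by those of `exp` is smooth on the line. -/
theorem contDiff_tsum_mul_pow (c : ℕ → ℝ) (hc : ∀ n, |c n| ≤ (n.factorial : ℝ)⁻¹) :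
    ContDiff ℝ ∞ fun y : ℝ => ∑' n, c n * y ^ n := by
  have hr : (FormalMultilinearSeries.ofScalars ℝ c).radius = ⊤ := by
    refine FormalMultilinearSeries.radius_eq_top_of_summable_norm _ fun r => ?_
    refine Summable.of_nonneg_of_le (fun n => by positivity) (fun n => ?_)
      (Real.summable_pow_div_factorial r)
    rw [FormalMultilinearSeries.ofScalars_norm, Real.norm_eq_abs, div_eq_inv_mul]
    gcongr
    exact hc n
  have h := (FormalMultilinearSeries.ofScalars ℝ c).hasFPowerSeriesOnBall (by simp [hr])
  have h2 : (FormalMultilinearSeries.ofScalars ℝ c).sum = fun y : ℝ => ∑' n, c n * y ^ n := by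
    exact FormalMultilinearSeries.ofScalarsSum_eq_tsum (E := ℝ) c
  rw [hr, h2] at h
  refine AnalyticOnNhd.contDiff fun y _ => h.analyticAt_of_mem (by simp)

/-- The entire function `∑ yⁿ / (2n)!`, equal to `cosh √y` for `y ≥ 0` and to `cos √(-y)` for
`y ≤ 0`. -/
noncomputable def cosSeries (y : ℝ) : ℝ := ∑' n : ℕ, ((2 * n).factorial : ℝ)⁻¹ * y ^ n

/-- The entire function `∑ yⁿ / (2n + 1)!`, equal to `sinh √y / √y` for `y > 0` and to
`sin √(-y) / √(-y)` for `y < 0`. -/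
noncomputable def sinSeries (y : ℝ) : ℝ := ∑' n : ℕ, ((2 * n + 1).factorial : ℝ)⁻¹ * y ^ n

theorem contDiff_cosSeries : ContDiff ℝ ∞ cosSeries := by
  refine contDiff_tsum_mul_pow _ fun n => ?_
  rw [abs_of_pos (by positivity)]
  gcongr
  omega

theorem contDiff_sinSeries : ContDiff ℝ ∞ sinSeries := by
  refine contDiff_tsum_mul_pow _ fun n => ?_
  rw [abs_of_pos (by positivity)]
  gcongr
  omega

theorem cosSeries_zero : cosSeries 0 = 1 := by
  rw [cosSeries, tsum_eq_single 0 (fun n hn => by simp [hn])]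
  simp

theorem sinSeries_zero : sinSeries 0 = 1 := by
  rw [sinSeries, tsum_eq_single 0 (fun n hn => by simp [hn])]
  simp

namespace SpaceForm

theorem gcos_eq_cosSeries (M : SpaceForm) (r : ℝ) :
    M.gcos r = cosSeries (-(M.curvature * r ^ 2)) := by
  cases M
  · simp [gcos, curvature, cosSeries_zero]
  · rw [gcos, Real.cos_eq_tsum, cosSeries]
    refine tsum_congr fun n => ?_
    rw [curvature, one_mul, neg_pow (r ^ 2), ← pow_mul]
    ring
  · rw [gcos, Real.cosh_eq_tsum, cosSeries]
    refine tsum_congr fun n => ?_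
    rw [curvature, neg_one_mul, neg_neg, ← pow_mul]
    ring

theorem gsin_eq_sinSeries (M : SpaceForm) (r : ℝ) :
    M.gsin r = r * sinSeries (-(M.curvature * r ^ 2)) := by
  cases M
  · simp [gsin, curvature, sinSeries_zero]
  · rw [gsin, Real.sin_eq_tsum, sinSeries, ← tsum_mul_left]
    refine tsum_congr fun n => ?_
    rw [curvature, one_mul, neg_pow (r ^ 2), ← pow_mul]
    ring
  · rw [gsin, Real.sinh_eq_tsum, sinSeries, ← tsum_mul_left]
    refine tsum_congr fun n => ?_
    rw [curvature, neg_one_mul, neg_neg, ← pow_mul]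
    ring

/-- The exponential map without the singular quotient `gsin ‖v‖ / ‖v‖`. -/
theorem expMap_eq_series (M : SpaceForm) {p v : M.Ambient} (hp : p ∈ M.carrier)
    (hv : v ∈ M.tangent p) :
    M.expMap p v = cosSeries (-(M.curvature * M.form v v)) • p
      + sinSeries (-(M.curvature * M.form v v)) • v := by
  rw [expMap, gcos_eq_cosSeries, gsin_eq_sinSeries, sq, M.sq_len hp hv]
  by_cases hl : M.len v = 0
  · have : v = 0 := M.eq_zero_of_form_self hp hv (by rw [← M.sq_len hp hv, hl, mul_zero])
    simp [this]
  · rw [mul_div_cancel_left₀ _ hl]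

/-! ### Calculus of the ambient form -/

/-- The ambient form as a continuous bilinear map. -/
noncomputable def formL (M : SpaceForm) : M.Ambient →L[ℝ] M.Ambient →L[ℝ] ℝ :=
  (LinearMap.mk₂ ℝ M.form M.form_add_left M.form_smul_left M.form_add_right
    M.form_smul_right).toContinuousBilinearMap

theorem formL_apply (M : SpaceForm) (x y : M.Ambient) : M.formL x y = M.form x y := rfl

theorem form_neg_left (M : SpaceForm) (x y : M.Ambient) : M.form (-x) y = -M.form x y := by
  rw [← neg_one_smul ℝ, form_smul_left, neg_one_mul]

theorem form_neg_right (M : SpaceForm) (x y : M.Ambient) : M.form x (-y) = -M.form x y := by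
  rw [form_comm, form_neg_left, form_comm]

theorem form_sub_left (M : SpaceForm) (x y z : M.Ambient) :
    M.form (x - y) z = M.form x z - M.form y z := by
  rw [sub_eq_add_neg, form_add_left, form_neg_left, sub_eq_add_neg]

theorem form_sub_right (M : SpaceForm) (x y z : M.Ambient) :
    M.form x (y - z) = M.form x y - M.form x z := by
  rw [form_comm, form_sub_left, form_comm, form_comm M z]

theorem hasDerivAt_form (M : SpaceForm) {X Y : ℝ → M.Ambient} {X' Y' : M.Ambient} {s : ℝ}
    (hX : HasDerivAt X X' s) (hY : HasDerivAt Y Y' s) :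
    HasDerivAt (fun s => M.form (X s) (Y s)) (M.form (X s) Y' + M.form X' (Y s)) s := by
  refine ((M.formL.hasFDerivAt.comp_hasDerivAt s hX).clm_apply hY).congr_deriv ?_
  simp only [Function.comp_apply, formL_apply]
  ring

/-- `⟨p, p⟩ = K` in `𝕊³` and `ℍ³`; the factor `K` makes this hold in `ℝ³` as well. -/
theorem curvature_mul_form_self (M : SpaceForm) {p : M.Ambient} (hp : p ∈ M.carrier) :
    M.curvature * M.form p p = M.curvature ^ 2 := by
  cases M
  · simp [curvature]
  · have h : form spherical p p = 1 := hp
    simp [curvature, h]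
  · have h : form hyperbolic p p = -1 := hp.1
    simp [curvature, h]

theorem curvature_mul_form_tangent (M : SpaceForm) {p v : M.Ambient} (hv : v ∈ M.tangent p) :
    M.curvature * M.form p v = 0 := by
  cases M
  · simp [curvature]
  · have h : form spherical p v = 0 := hv
    simp [h]
  · have h : form hyperbolic p v = 0 := hv
    simp [h]

theorem mem_tangent_iff (M : SpaceForm) {p v : M.Ambient} :
    v ∈ M.tangent p ↔ M.curvature * M.form p v = 0 := by
  refine ⟨M.curvature_mul_form_tangent, fun h => ?_⟩
  cases M
  · trivial
  · change form spherical p v = 0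
    simpa [curvature] using h
  · change form hyperbolic p v = 0
    simpa [curvature] using h

/-- A curve that stays in `M` has velocities tangent to `M`. -/
theorem tangent_of_hasDerivAt (M : SpaceForm) {c : ℝ → M.Ambient} {v : M.Ambient} {s : ℝ}
    (hc : ∀ᶠ t in nhds s, c t ∈ M.carrier) (h : HasDerivAt c v s) : v ∈ M.tangent (c s) := by
  rw [mem_tangent_iff]
  have h1 := (M.hasDerivAt_form h h).const_mul M.curvature
  have h2 : HasDerivAt (fun t => M.curvature * M.form (c t) (c t)) 0 s :=
    (hasDerivAt_const s (M.curvature ^ 2)).congr_of_eventuallyEq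
      (hc.mono fun t ht => M.curvature_mul_form_self ht)
  have h3 := h1.unique h2
  rw [M.form_comm v] at h3
  linarith

end SpaceForm

namespace SpaceForm

/-! ### The Killing field of a Frenet curve -/

namespace IsFrenetCurve

variable {M : SpaceForm} {I : Set ℝ} {γ T N B : ℝ → M.Ambient} {k₁ k₂ : ℝ → ℝ} {s : ℝ}

theorem hasDerivAt_curve (hγ : M.IsFrenetCurve I γ T N B k₁ k₂) (hI : IsOpen I) (hs : s ∈ I) :
    HasDerivAt γ (T s) s := by
  rw [hγ.velocity s hs]
  exact ((hγ.smooth_curve.contDiffAt (hI.mem_nhds hs)).differentiableAt (by simp)).hasDerivAt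

theorem tangent_T (hγ : M.IsFrenetCurve I γ T N B k₁ k₂) (hI : IsOpen I) (hs : s ∈ I) :
    T s ∈ M.tangent (γ s) :=
  M.tangent_of_hasDerivAt ((hI.eventually_mem hs).mono hγ.mem) (hγ.hasDerivAt_curve hI hs)

/-- The ambient derivative of a tangent field `X` is recovered from `DX/ds`: its normal part is
`-K ⟨X, γ'⟩ γ`, by differentiating `⟨X, γ⟩ = 0`. -/
theorem hasDerivAt_of_covDeriv (hγ : M.IsFrenetCurve I γ T N B k₁ k₂) (hI : IsOpen I)
    (hs : s ∈ I) {X : ℝ → M.Ambient} (hX : DifferentiableAt ℝ X s)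
    (ht : ∀ t ∈ I, X t ∈ M.tangent (γ t)) :
    HasDerivAt X (M.covDeriv γ X s - (M.curvature * M.form (X s) (T s)) • γ s) s := by
  have h1 := (M.hasDerivAt_form hX.hasDerivAt (hγ.hasDerivAt_curve hI hs)).const_mul M.curvature
  have h2 : HasDerivAt (fun t => M.curvature * M.form (X t) (γ t)) 0 s :=
    (hasDerivAt_const s 0).congr_of_eventuallyEq ((hI.eventually_mem hs).mono fun t h => by
      simpa only [M.form_comm] using M.curvature_mul_form_tangent (ht t h))
  have h3 := h1.unique h2
  refine hX.hasDerivAt.congr_deriv ?_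
  rw [covDeriv]
  match_scalars
  · ring
  · linarith

theorem hasDerivAt_T (hγ : M.IsFrenetCurve I γ T N B k₁ k₂) (hI : IsOpen I) (hs : s ∈ I) :
    HasDerivAt T (k₁ s • N s - M.curvature • γ s) s := by
  have hT : ContDiffOn ℝ ∞ T I :=
    (hγ.smooth_curve.deriv_of_isOpen hI (by simp)).congr hγ.velocity
  have h := hγ.hasDerivAt_of_covDeriv hI hs
    ((hT.contDiffAt (hI.mem_nhds hs)).differentiableAt (by simp)) fun t ht => hγ.tangent_T hI ht
  rwa [hγ.frenet_T s hs, hγ.unit_T s hs, mul_one] at h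

theorem hasDerivAt_N (hγ : M.IsFrenetCurve I γ T N B k₁ k₂) (hI : IsOpen I) (hs : s ∈ I) :
    HasDerivAt N (-(k₁ s • T s) + k₂ s • B s) s := by
  have h := hγ.hasDerivAt_of_covDeriv hI hs
    ((hγ.smooth_N.contDiffAt (hI.mem_nhds hs)).differentiableAt (by simp)) hγ.tangent_N
  rwa [hγ.frenet_N s hs, M.form_comm, hγ.orth_TN s hs, mul_zero, zero_smul, sub_zero] at h

theorem hasDerivAt_B (hγ : M.IsFrenetCurve I γ T N B k₁ k₂) (hI : IsOpen I) (hs : s ∈ I) :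
    HasDerivAt B (-(k₂ s • N s)) s := by
  have h := hγ.hasDerivAt_of_covDeriv hI hs
    ((hγ.smooth_B.contDiffAt (hI.mem_nhds hs)).differentiableAt (by simp)) hγ.tangent_B
  rwa [hγ.frenet_B s hs, M.form_comm, hγ.orth_TB s hs, mul_zero, zero_smul, sub_zero] at h

end IsFrenetCurve

/-- The infinitesimal isometry of `M`, as an affine vector field on the ambient space, that
transports a Frenet frame `t`, `n`, `b` at the point `p` with curvature scalars `k₁`, `k₂`: it takes
the value `t` at `p`, and its linear part maps `t`, `n`, `b` to the ambient derivatives prescribed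
by the Frenet-Serret equations. For `𝕊³` and `ℍ³` it is linear and lies in the Lie algebra of the
isometry group of the ambient form. -/
noncomputable def frenetField (M : SpaceForm) (p t n b : M.Ambient) (k₁ k₂ : ℝ) (x : M.Ambient) :
    M.Ambient :=
  M.curvature • (M.form (x - p) p • t - M.form (x - p) t • p)
    + k₁ • (M.form (x - p) t • n - M.form (x - p) n • t)
    + k₂ • (M.form (x - p) n • b - M.form (x - p) b • n) + t

/-- Along a Frenet curve with constant curvature scalars the field `frenetField` does not depend on
the parameter: in the expansion of its derivative all terms cancel in pairs, because the matrix of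
the Frenet-Serret equations is skew. -/
theorem IsFrenetCurve.frenetField_eq {M : SpaceForm} {I : Set ℝ} {γ T N B : ℝ → M.Ambient}
    {k₁ k₂ : ℝ → ℝ} (hγ : M.IsFrenetCurve I γ T N B k₁ k₂) (hI : IsOpen I) (hI' : I.OrdConnected)
    (hk₁ : ∀ s ∈ I, ∀ s' ∈ I, k₁ s = k₁ s') (hk₂ : ∀ s ∈ I, ∀ s' ∈ I, k₂ s = k₂ s')
    {s s' : ℝ} (hs : s ∈ I) (hs' : s' ∈ I) (x : M.Ambient) :
    M.frenetField (γ s) (T s) (N s) (B s) (k₁ s) (k₂ s) x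
      = M.frenetField (γ s') (T s') (N s') (B s') (k₁ s') (k₂ s') x := by
  have key : ∀ t ∈ I, HasDerivAt
      (fun t => M.frenetField (γ t) (T t) (N t) (B t) (k₁ s) (k₂ s) x) 0 t := by
    intro t ht
    have dγ := hγ.hasDerivAt_curve hI ht
    have dT := hγ.hasDerivAt_T hI ht
    have dN := hγ.hasDerivAt_N hI ht
    have dB := hγ.hasDerivAt_B hI ht
    have dx := (hasDerivAt_const t x).sub dγ
    have h := ((((((M.hasDerivAt_form dx dγ).smul dT).sub
        ((M.hasDerivAt_form dx dT).smul dγ)).const_smul M.curvature).add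
      ((((M.hasDerivAt_form dx dT).smul dN).sub
        ((M.hasDerivAt_form dx dN).smul dT)).const_smul (k₁ s))).add
      ((((M.hasDerivAt_form dx dN).smul dB).sub
        ((M.hasDerivAt_form dx dB).smul dN)).const_smul (k₂ s))).add dT
    refine h.congr_deriv ?_
    rw [hk₁ t ht s hs, hk₂ t ht s hs]
    have e1 := M.curvature_mul_form_tangent (hγ.tangent_T hI ht)
    simp only [zero_sub, Pi.sub_apply, form_sub_left, form_sub_right, form_neg_left, form_neg_right,
      form_add_right, form_smul_right, hγ.unit_T t ht, hγ.orth_TN t ht, hγ.orth_TB t ht]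
    have e2 := M.form_comm (T t) (γ t)
    rw [e2]
    match_scalars
    all_goals first | ring1 | linear_combination e1 | linear_combination -e1
  have hc := hI.is_const_of_deriv_eq_zero hI'.isPreconnected
    (fun t ht => (key t ht).differentiableAt.differentiableWithinAt)
    (fun t ht => (key t ht).deriv) hs hs'
  rw [hc, hk₁ s hs s' hs', hk₂ s hs s' hs']

/-- On the normal slice of the curve at `γ s` the field is computed from the Frenet-Serret
equations. The coefficient of `γ s` is `1` in `ℝ³`, where `γ s` need not be orthogonal to the
frame. -/
theorem IsFrenetCurve.frenetField_apply {M : SpaceForm} {I : Set ℝ} {γ T N B : ℝ → M.Ambient}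
    {k₁ k₂ : ℝ → ℝ} (hγ : M.IsFrenetCurve I γ T N B k₁ k₂) (hI : IsOpen I)
    {s : ℝ} (hs : s ∈ I) {c : ℝ} (hc : c = 1 + M.curvature ^ 2 * (c - 1)) (a b : ℝ) :
    M.frenetField (γ s) (T s) (N s) (B s) (k₁ s) (k₂ s) (c • γ s + a • N s + b • B s)
      = c • T s + a • (-(k₁ s • T s) + k₂ s • B s) + b • (-(k₂ s • N s)) := by
  have e0 := M.curvature_mul_form_self (hγ.mem s hs)
  have eT := M.curvature_mul_form_tangent (hγ.tangent_T hI hs)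
  have eN := M.curvature_mul_form_tangent (hγ.tangent_N s hs)
  have eB := M.curvature_mul_form_tangent (hγ.tangent_B s hs)
  -- `c - 1` vanishes in `ℝ³`, and elsewhere `γ` is orthogonal to the frame
  have e (v : M.Ambient) (h : M.curvature * M.form (γ s) v = 0) :
      (c - 1) * M.form (γ s) v = 0 := by
    rw [show c - 1 = M.curvature ^ 2 * (c - 1) by linarith]
    linear_combination M.curvature * (c - 1) * h
  have dT := e _ eT
  have dN := e _ eN
  have dB := e _ eB
  rw [frenetField]
  simp only [form_sub_left, form_add_left, form_smul_left, hγ.unit_N s hs, hγ.unit_B s hs,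
    hγ.orth_NB s hs, M.form_comm (N s) (T s), M.form_comm (B s) (T s), M.form_comm (B s) (N s),
    M.form_comm (N s) (γ s), M.form_comm (B s) (γ s), hγ.orth_TN s hs, hγ.orth_TB s hs]
  match_scalars
  · linear_combination (c - 1) * e0 + a * eN + b * eB - k₁ s * dN - hc
  · linear_combination -M.curvature * dT
  · linear_combination k₁ s * dT - k₂ s * dB
  · linear_combination k₂ s * dN

end SpaceForm

/-! ### The first fundamental form of the tube -/

/-- Derivative of a combination of moving vectors with coefficients that depend on the second
coordinate only. -/
theorem hasFDerivAt_smul_coord {E : Type*} [NormedAddCommGroup E] [NormedSpace ℝ E]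
    {P : ℝ → ℝ} {X : ℝ → E} {P' : ℝ} {X' : E} {q : Fin 2 → ℝ} (hP : HasDerivAt P P' (q 1))
    (hX : HasDerivAt X X' (q 0)) :
    HasFDerivAt (fun q : Fin 2 → ℝ => P (q 1) • X (q 0))
      ((ContinuousLinearMap.proj (R := ℝ) (φ := fun _ : Fin 2 => ℝ) 0).smulRight (P (q 1) • X')
        + (ContinuousLinearMap.proj (R := ℝ) (φ := fun _ : Fin 2 => ℝ) 1).smulRight
          (P' • X (q 0))) q := by
  have h0 := (ContinuousLinearMap.proj (R := ℝ) (φ := fun _ : Fin 2 => ℝ) 0).hasFDerivAt (x := q)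
  have h1 := (ContinuousLinearMap.proj (R := ℝ) (φ := fun _ : Fin 2 => ℝ) 1).hasFDerivAt (x := q)
  have h := (hP.hasFDerivAt.comp q h1).smul (hX.hasFDerivAt.comp q h0)
  refine h.congr_fderiv ?_
  ext v
  simp [smul_smul, mul_comm]

namespace SpaceForm

/-- The Gram determinant of two linearly independent tangent vectors does not vanish. -/
theorem gram_ne_zero (M : SpaceForm) {p u v : M.Ambient} (hp : p ∈ M.carrier)
    (hu : u ∈ M.tangent p) (hv : v ∈ M.tangent p) (h : LinearIndependent ℝ ![u, v]) :
    M.form u u * M.form v v - M.form u v ^ 2 ≠ 0 := by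
  intro h0
  rw [LinearIndependent.pair_iff] at h
  -- the component of `u` orthogonal to `v`, scaled by `⟨v, v⟩`, has length `0`
  have hw : M.form v v • u + (-M.form u v) • v = 0 := by
    refine M.eq_zero_of_form_self hp ?_ ?_
    · rw [mem_tangent_iff] at *
      rw [form_add_right, form_smul_right, form_smul_right]
      linear_combination M.form v v * hu - M.form u v * hv
    · simp only [form_add_left, form_add_right, form_smul_left, form_smul_right, M.form_comm v u]
      linear_combination M.form v v * h0
  have hvv := (h _ _ hw).1
  have hv0 := M.eq_zero_of_form_self hp hv hvv
  have := (h 0 1 (by simp [hv0])).2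
  norm_num at this

/-- Over `I` the tube is `P(ψ) γ(s) + Q(ψ) N(s) + R(ψ) B(s)` with smooth coefficients, also
where the profile curve passes through the origin; `P = 1` in `ℝ³`. -/
theorem IsFrenetCurve.exists_generalizedTube_eq {M : SpaceForm} {I : Set ℝ}
    {γ T N B : ℝ → M.Ambient} {k₁ k₂ : ℝ → ℝ} (hγ : M.IsFrenetCurve I γ T N B k₁ k₂) {f g : ℝ → ℝ}
    (hfg : IsSimpleClosedPlaneCurve f g) (ρ₀ : ℝ) :
    ∃ P Q R : ℝ → ℝ, ContDiff ℝ ∞ P ∧ ContDiff ℝ ∞ Q ∧ ContDiff ℝ ∞ R ∧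
      (∀ ψ, P ψ = 1 + M.curvature ^ 2 * (P ψ - 1)) ∧
      ∀ q : Fin 2 → ℝ, q 0 ∈ I → M.generalizedTube γ N B f g ρ₀ q ∈ M.carrier ∧
        M.generalizedTube γ N B f g ρ₀ q
          = P (q 1) • γ (q 0) + Q (q 1) • N (q 0) + R (q 1) • B (q 0) := by
  have ha : ContDiff ℝ ∞ fun ψ => ρ₀ * f ψ := contDiff_const.mul hfg.smooth_f
  have hb : ContDiff ℝ ∞ fun ψ => ρ₀ * g ψ := contDiff_const.mul hfg.smooth_g
  have hr : ContDiff ℝ ∞ fun ψ => -(M.curvature * ((ρ₀ * f ψ) ^ 2 + (ρ₀ * g ψ) ^ 2)) :=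
    (contDiff_const.mul ((ha.pow 2).add (hb.pow 2))).neg
  refine ⟨_, _, _, contDiff_cosSeries.comp hr, (contDiff_sinSeries.comp hr).mul ha,
    (contDiff_sinSeries.comp hr).mul hb, fun ψ => ?_, fun q hq => ?_⟩
  · cases M
    · simp [curvature, cosSeries_zero]
    · simp [curvature]
    · simp [curvature]
  · have hv : (ρ₀ * f (q 1)) • N (q 0) + (ρ₀ * g (q 1)) • B (q 0) ∈ M.tangent (γ (q 0)) := by
      have hN := hγ.tangent_N _ hq
      have hB := hγ.tangent_B _ hq
      rw [mem_tangent_iff] at *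
      rw [form_add_right, form_smul_right, form_smul_right]
      linear_combination (ρ₀ * f (q 1)) * hN + (ρ₀ * g (q 1)) * hB
    refine ⟨M.expMap_mem (hγ.mem _ hq) hv, ?_⟩
    have hvv : M.form ((ρ₀ * f (q 1)) • N (q 0) + (ρ₀ * g (q 1)) • B (q 0))
        ((ρ₀ * f (q 1)) • N (q 0) + (ρ₀ * g (q 1)) • B (q 0))
          = (ρ₀ * f (q 1)) ^ 2 + (ρ₀ * g (q 1)) ^ 2 := by
      simp only [form_add_left, form_add_right, form_smul_left, form_smul_right, hγ.unit_N _ hq,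
        hγ.unit_B _ hq, hγ.orth_NB _ hq, M.form_comm (B (q 0)) (N (q 0))]
      ring
    rw [generalizedTube, expMap_eq_series M (hγ.mem _ hq) hv, hvv]
    simp only [Function.comp_apply]
    module

/-- The coordinate vector fields of a tube `P(ψ) γ(s) + Q(ψ) N(s) + R(ψ) B(s)`. -/
theorem IsFrenetCurve.partialDeriv_tube {M : SpaceForm} {I : Set ℝ}
    {γ T N B : ℝ → M.Ambient} {k₁ k₂ : ℝ → ℝ} (hγ : M.IsFrenetCurve I γ T N B k₁ k₂)
    (hI : IsOpen I) {P Q R : ℝ → ℝ} (hP : Differentiable ℝ P) (hQ : Differentiable ℝ Q)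
    (hR : Differentiable ℝ R) {β : (Fin 2 → ℝ) → M.Ambient}
    (hβ : ∀ q : Fin 2 → ℝ, q 0 ∈ I →
      β q = P (q 1) • γ (q 0) + Q (q 1) • N (q 0) + R (q 1) • B (q 0))
    {q : Fin 2 → ℝ} (hq : q 0 ∈ I) :
    DifferentiableAt ℝ β q ∧
    M.partialDeriv β 0 q = P (q 1) • T (q 0)
        + Q (q 1) • (-(k₁ (q 0) • T (q 0)) + k₂ (q 0) • B (q 0))
        + R (q 1) • (-(k₂ (q 0) • N (q 0))) ∧
    M.partialDeriv β 1 q = deriv P (q 1) • γ (q 0) + deriv Q (q 1) • N (q 0)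
        + deriv R (q 1) • B (q 0) := by
  have h := ((hasFDerivAt_smul_coord (hP (q 1)).hasDerivAt (hγ.hasDerivAt_curve hI hq)).add
    (hasFDerivAt_smul_coord (hQ (q 1)).hasDerivAt (hγ.hasDerivAt_N hI hq))).add
    (hasFDerivAt_smul_coord (hR (q 1)).hasDerivAt (hγ.hasDerivAt_B hI hq))
  have hU : IsOpen {q : Fin 2 → ℝ | q 0 ∈ I} := hI.preimage (continuous_apply 0)
  have h' := h.congr_of_eventuallyEq ((hU.eventually_mem hq).mono hβ)
  refine ⟨h'.differentiableAt, ?_, ?_⟩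
  · rw [partialDeriv, h'.fderiv]
    simp
  · rw [partialDeriv, h'.fderiv]
    simp

/-- The coordinate vector fields of a parametrized submanifold of `M` are tangent to `M`. -/
theorem partialDeriv_mem_tangent (M : SpaceForm) {n : ℕ} {β : (Fin n → ℝ) → M.Ambient}
    {q : Fin n → ℝ} (hβ : DifferentiableAt ℝ β q) (hc : ∀ᶠ x in nhds q, β x ∈ M.carrier)
    (i : Fin n) : M.partialDeriv β i q ∈ M.tangent (β q) := by
  have hl : HasDerivAt (fun t : ℝ => q + t • (Pi.single i 1 : Fin n → ℝ)) (Pi.single i 1) 0 := by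
    simpa using ((hasDerivAt_id (0 : ℝ)).smul_const (Pi.single i 1 : Fin n → ℝ)).const_add q
  have hq : q + (0 : ℝ) • (Pi.single i 1 : Fin n → ℝ) = q := by simp
  have h := HasFDerivAt.comp_hasDerivAt (l := β) (l' := fderiv ℝ β q) 0
    (by rw [hq]; exact hβ.hasFDerivAt) hl
  have h2 := M.tangent_of_hasDerivAt ?_ h
  · simpa [partialDeriv] using h2
  · have h3 := hl.continuousAt.tendsto
    rw [hq] at h3
    exact h3.eventually hc

/-- The first fundamental form of a tube around a Frenet curve with constant curvature scalars. -/
theorem IsFrenetCurve.form_partialDeriv_tube {M : SpaceForm} {I : Set ℝ}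
    {γ T N B : ℝ → M.Ambient} {k₁ k₂ : ℝ → ℝ} (hγ : M.IsFrenetCurve I γ T N B k₁ k₂)
    (hI : IsOpen I) {P Q R : ℝ → ℝ} (hP : Differentiable ℝ P) (hQ : Differentiable ℝ Q)
    (hR : Differentiable ℝ R) (hP1 : ∀ ψ, P ψ = 1 + M.curvature ^ 2 * (P ψ - 1))
    {β : (Fin 2 → ℝ) → M.Ambient}
    (hβ : ∀ q : Fin 2 → ℝ, q 0 ∈ I →
      β q = P (q 1) • γ (q 0) + Q (q 1) • N (q 0) + R (q 1) • B (q 0))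
    {q : Fin 2 → ℝ} (hq : q 0 ∈ I) :
    M.form (M.partialDeriv β 0 q) (M.partialDeriv β 0 q)
        = (P (q 1) - k₁ (q 0) * Q (q 1)) ^ 2 + (k₂ (q 0) * R (q 1)) ^ 2
          + (k₂ (q 0) * Q (q 1)) ^ 2 ∧
    M.form (M.partialDeriv β 0 q) (M.partialDeriv β 1 q)
        = k₂ (q 0) * (Q (q 1) * deriv R (q 1) - R (q 1) * deriv Q (q 1)) ∧
    M.form (M.partialDeriv β 1 q) (M.partialDeriv β 1 q)
        = M.curvature * deriv P (q 1) ^ 2 + deriv Q (q 1) ^ 2 + deriv R (q 1) ^ 2 := by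
  obtain ⟨-, h0, h1⟩ := hγ.partialDeriv_tube hI hP hQ hR hβ hq
  -- in `ℝ³` the products of `γ` with the frame are arbitrary, but there `P' = 0`
  have hP' : deriv P (q 1) = M.curvature ^ 2 * deriv P (q 1) := by
    have h2 := (((hP (q 1)).hasDerivAt.sub_const 1).const_mul (M.curvature ^ 2)).const_add 1
    exact (hP (q 1)).hasDerivAt.unique (h2.congr_of_eventuallyEq (.of_forall hP1))
  have e (v : M.Ambient) (h : M.curvature * M.form (γ (q 0)) v = 0) :
      deriv P (q 1) * M.form (γ (q 0)) v = 0 := by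
    rw [hP']
    linear_combination M.curvature * deriv P (q 1) * h
  have eT := e _ (M.curvature_mul_form_tangent (hγ.tangent_T hI hq))
  have eN := e _ (M.curvature_mul_form_tangent (hγ.tangent_N _ hq))
  have eB := e _ (M.curvature_mul_form_tangent (hγ.tangent_B _ hq))
  have e0 : deriv P (q 1) * M.form (γ (q 0)) (γ (q 0)) = M.curvature * deriv P (q 1) := by
    rw [hP']
    linear_combination M.curvature * deriv P (q 1) * M.curvature_mul_form_self (hγ.mem _ hq)
  rw [h0, h1]
  simp only [form_add_left, form_add_right, form_smul_left, form_smul_right, form_neg_left,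
    form_neg_right, M.form_comm (B (q 0)) (N (q 0)), M.form_comm (N (q 0)) (T (q 0)),
    M.form_comm (B (q 0)) (T (q 0)), M.form_comm (N (q 0)) (γ (q 0)),
    M.form_comm (B (q 0)) (γ (q 0)), M.form_comm (T (q 0)) (γ (q 0)), hγ.unit_T _ hq,
    hγ.unit_N _ hq, hγ.unit_B _ hq, hγ.orth_TN _ hq, hγ.orth_TB _ hq, hγ.orth_NB _ hq]
  refine ⟨by ring, ?_, ?_⟩
  · linear_combination (P (q 1) - k₁ (q 0) * Q (q 1)) * eT - k₂ (q 0) * R (q 1) * eN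
      + k₂ (q 0) * Q (q 1) * eB
  · linear_combination deriv P (q 1) * e0 + 2 * deriv Q (q 1) * eN + 2 * deriv R (q 1) * eB

end SpaceForm

/-! ### Geodesic Hamiltonians of surfaces with an ignorable coordinate -/

theorem poissonBracket_self {n : ℕ} (F : (Fin n → ℝ) × (Fin n → ℝ) → ℝ)
    (x : (Fin n → ℝ) × (Fin n → ℝ)) : poissonBracket F F x = 0 :=
  Finset.sum_eq_zero fun i _ => by ring

theorem poissonBracket_swap {n : ℕ} (F G : (Fin n → ℝ) × (Fin n → ℝ) → ℝ)
    (x : (Fin n → ℝ) × (Fin n → ℝ)) : poissonBracket F G x = -poissonBracket G F x := by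
  rw [poissonBracket, poissonBracket, ← Finset.sum_neg_distrib]
  exact Finset.sum_congr rfl fun i _ => by ring

theorem poissonBracket_congr {n : ℕ} {F F' G G' : (Fin n → ℝ) × (Fin n → ℝ) → ℝ}
    {x : (Fin n → ℝ) × (Fin n → ℝ)} (hF : F =ᶠ[nhds x] F') (hG : G =ᶠ[nhds x] G') :
    poissonBracket F G x = poissonBracket F' G' x := by
  rw [poissonBracket, poissonBracket, hF.fderiv_eq, hG.fderiv_eq]

theorem fderiv_momentum {n : ℕ} (i : Fin n) (x v : (Fin n → ℝ) × (Fin n → ℝ)) :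
    fderiv ℝ (fun x : (Fin n → ℝ) × (Fin n → ℝ) => x.2 i) x v = v.2 i :=
  congrArg (fun L => L v) ((ContinuousLinearMap.proj (R := ℝ) (φ := fun _ : Fin n => ℝ) i).comp
    (ContinuousLinearMap.snd ℝ (Fin n → ℝ) (Fin n → ℝ))).fderiv

/-- The bracket of a function with the momentum `p_i` is its derivative along `q_i`. -/
theorem poissonBracket_momentum {n : ℕ} (F : (Fin n → ℝ) × (Fin n → ℝ) → ℝ) (i : Fin n)
    (x : (Fin n → ℝ) × (Fin n → ℝ)) :
    poissonBracket F (fun x => x.2 i) x = fderiv ℝ F x (Pi.single i 1, 0) := by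
  simp [poissonBracket, fderiv_momentum, Pi.single_apply]

/-- The Hamiltonian `½ g^ij p_i p_j` of the metric `E dq₀² + 2 F dq₀ dq₁ + G dq₁²` whose
coefficients depend on `q₁` only. -/
noncomputable def ignorableHamiltonian (E F G : ℝ → ℝ) (x : (Fin 2 → ℝ) × (Fin 2 → ℝ)) : ℝ :=
  (G (x.1 1) * x.2 0 ^ 2 - 2 * F (x.1 1) * x.2 0 * x.2 1 + E (x.1 1) * x.2 1 ^ 2)
    / (2 * (E (x.1 1) * G (x.1 1) - F (x.1 1) ^ 2))

section

variable {E F G : ℝ → ℝ}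

theorem contDiff_ignorableHamiltonian (hE : ContDiff ℝ ∞ E) (hF : ContDiff ℝ ∞ F)
    (hG : ContDiff ℝ ∞ G) (hd : ∀ ψ, E ψ * G ψ - F ψ ^ 2 ≠ 0) :
    ContDiff ℝ ∞ (ignorableHamiltonian E F G) := by
  have h1 : ContDiff ℝ ∞ fun x : (Fin 2 → ℝ) × (Fin 2 → ℝ) => x.1 1 := by fun_prop
  have hE' := hE.comp h1
  have hF' := hF.comp h1
  have hG' := hG.comp h1
  simp only [Function.comp_def] at hE' hF' hG'
  refine ContDiff.div (by fun_prop) (by fun_prop) fun x => mul_ne_zero two_ne_zero (hd _)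

theorem fderiv_ignorableHamiltonian_coord (hE : ContDiff ℝ ∞ E) (hF : ContDiff ℝ ∞ F)
    (hG : ContDiff ℝ ∞ G) (hd : ∀ ψ, E ψ * G ψ - F ψ ^ 2 ≠ 0) (x : (Fin 2 → ℝ) × (Fin 2 → ℝ)) :
    fderiv ℝ (ignorableHamiltonian E F G) x (Pi.single 0 1, 0) = 0 := by
  have h := (contDiff_ignorableHamiltonian hE hF hG hd).differentiable (by simp) x
  rw [← h.lineDeriv_eq_fderiv, lineDeriv]
  simp [ignorableHamiltonian]

theorem fderiv_ignorableHamiltonian_momentum (hE : ContDiff ℝ ∞ E) (hF : ContDiff ℝ ∞ F)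
    (hG : ContDiff ℝ ∞ G) (hd : ∀ ψ, E ψ * G ψ - F ψ ^ 2 ≠ 0) (x : (Fin 2 → ℝ) × (Fin 2 → ℝ)) :
    fderiv ℝ (ignorableHamiltonian E F G) x (0, Pi.single 1 1)
      = (E (x.1 1) * x.2 1 - F (x.1 1) * x.2 0) / (E (x.1 1) * G (x.1 1) - F (x.1 1) ^ 2) := by
  have h := (contDiff_ignorableHamiltonian hE hF hG hd).differentiable (by simp) x
  rw [← h.lineDeriv_eq_fderiv, lineDeriv]
  have h1 : HasDerivAt (fun t : ℝ => x.2 1 + t) 1 0 := (hasDerivAt_id _).const_add _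
  have h2 := (((h1.const_mul (2 * F (x.1 1) * x.2 0)).const_sub (G (x.1 1) * x.2 0 ^ 2)).add
    ((h1.pow 2).const_mul (E (x.1 1)))).div_const (2 * (E (x.1 1) * G (x.1 1) - F (x.1 1) ^ 2))
  have h3 : (fun t : ℝ => ignorableHamiltonian E F G (x + t • (0, Pi.single 1 1))) = fun t =>
      (G (x.1 1) * x.2 0 ^ 2 - 2 * F (x.1 1) * x.2 0 * (x.2 1 + t) + E (x.1 1) * (x.2 1 + t) ^ 2)
        / (2 * (E (x.1 1) * G (x.1 1) - F (x.1 1) ^ 2)) := by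
    funext t
    simp [ignorableHamiltonian]
  rw [h3]
  refine h2.deriv.trans ?_
  have := hd (x.1 1)
  field_simp
  simp
  ring

/-- The locus where the differentials of the Hamiltonian and of `p₀` may become dependent is null:
over each `q` it is a line of covectors. -/
theorem ae_mul_momentum_ne (hE : Continuous E) (hF : Continuous F) (hE0 : ∀ ψ, E ψ ≠ 0) :
    ∀ᵐ x : (Fin 2 → ℝ) × (Fin 2 → ℝ), E (x.1 1) * x.2 1 - F (x.1 1) * x.2 0 ≠ 0 := by
  have hc : IsClosed {x : (Fin 2 → ℝ) × (Fin 2 → ℝ) |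
      E (x.1 1) * x.2 1 - F (x.1 1) * x.2 0 = 0} := isClosed_eq (by fun_prop) continuous_const
  rw [MeasureTheory.ae_iff]
  simp only [ne_eq, not_not]
  rw [MeasureTheory.Measure.volume_eq_prod, MeasureTheory.Measure.measure_prod_null
    hc.measurableSet]
  refine .of_forall fun q => ?_
  let L : (Fin 2 → ℝ) →ₗ[ℝ] ℝ := E (q 1) • LinearMap.proj 1 - F (q 1) • LinearMap.proj 0
  have hL : L.ker ≠ ⊤ := fun h => hE0 (q 1) <| by
    have h1 : (Pi.single 1 1 : Fin 2 → ℝ) ∈ L.ker := h ▸ Submodule.mem_top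
    simpa [L] using h1
  exact MeasureTheory.Measure.addHaar_submodule MeasureTheory.volume _ hL

end

namespace SpaceForm

/-- The geodesic flow of a surface on which the metric depends on `q₁` only is integrable as soon as
the momentum `p₀` descends to the cotangent bundle, which is achieved by a vector field `X` on the
ambient space that extends `∂₀β`. -/
theorem hamiltonian_eq_and_liouvilleIntegrable (M : SpaceForm) {U : Set (Fin 2 → ℝ)}
    (hU : IsOpen U) {β : (Fin 2 → ℝ) → M.Ambient} {E F G : ℝ → ℝ} (hE : ContDiff ℝ ∞ E)
    (hF : ContDiff ℝ ∞ F) (hG : ContDiff ℝ ∞ G) (hE0 : ∀ ψ, E ψ ≠ 0)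
    (hd : ∀ ψ, E ψ * G ψ - F ψ ^ 2 ≠ 0)
    (h00 : ∀ q ∈ U, M.form (M.partialDeriv β 0 q) (M.partialDeriv β 0 q) = E (q 1))
    (h01 : ∀ q ∈ U, M.form (M.partialDeriv β 0 q) (M.partialDeriv β 1 q) = F (q 1))
    (h11 : ∀ q ∈ U, M.form (M.partialDeriv β 1 q) (M.partialDeriv β 1 q) = G (q 1))
    (X : M.Ambient → M.Ambient) (hX : ∀ q ∈ U, X (β q) = M.partialDeriv β 0 q) :
    (∀ q ∈ U, ∀ p, M.hamiltonian β (q, p) = ignorableHamiltonian E F G (q, p)) ∧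
    M.LiouvilleIntegrable U β := by
  have hinv : ∀ q ∈ U, ∀ p, (M.inducedMetric β q)⁻¹ *ᵥ p =
      ![(G (q 1) * p 0 - F (q 1) * p 1) / (E (q 1) * G (q 1) - F (q 1) ^ 2),
        (E (q 1) * p 1 - F (q 1) * p 0) / (E (q 1) * G (q 1) - F (q 1) ^ 2)] := by
    intro q hq p
    have hm : M.inducedMetric β q = !![E (q 1), F (q 1); F (q 1), G (q 1)] := by
      ext i j
      fin_cases i <;> fin_cases j <;> simp [inducedMetric, h00 q hq, h01 q hq, h11 q hq]
      rw [M.form_comm, h01 q hq]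
    rw [hm, Matrix.inv_def, Matrix.adjugate_fin_two_of, Matrix.det_fin_two_of,
      Ring.inverse_eq_inv']
    ext i
    fin_cases i <;> simp [Matrix.mulVec, dotProduct, Fin.sum_univ_two] <;> ring
  have hH : ∀ q ∈ U, ∀ p, M.hamiltonian β (q, p) = ignorableHamiltonian E F G (q, p) := by
    intro q hq p
    rw [hamiltonian, hinv q hq]
    simp only [dotProduct, Fin.sum_univ_two, ignorableHamiltonian, Matrix.cons_val_zero,
      Matrix.cons_val_one]
    have := hd (q 1)
    field_simp
    ring
  refine ⟨hH, ?_⟩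
  have hcot : ∀ q ∈ U, ∀ p, M.cotangentMap β (q, p) = (β q,
      ((G (q 1) * p 0 - F (q 1) * p 1) / (E (q 1) * G (q 1) - F (q 1) ^ 2)) • M.partialDeriv β 0 q
      + ((E (q 1) * p 1 - F (q 1) * p 0) / (E (q 1) * G (q 1) - F (q 1) ^ 2))
        • M.partialDeriv β 1 q) := fun q hq p => by
    simp [cotangentMap, hinv q hq]
  have hΦ0 : ∀ q ∈ U, ∀ p, 1 / 2 * M.form (M.cotangentMap β (q, p)).2 (M.cotangentMap β (q, p)).2
      = ignorableHamiltonian E F G (q, p) := by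
    intro q hq p
    rw [hcot q hq]
    simp only [form_add_left, form_add_right, form_smul_left, form_smul_right, h00 q hq,
      h01 q hq, h11 q hq, ignorableHamiltonian,
      M.form_comm (M.partialDeriv β 1 q) (M.partialDeriv β 0 q)]
    rw [mul_comm (2 : ℝ), ← div_div]
    simp only [div_eq_mul_inv _ (E (q 1) * G (q 1) - F (q 1) ^ 2)]
    linear_combination 1 / 2 * (E (q 1) * G (q 1) - F (q 1) ^ 2)⁻¹ * (G (q 1) * p 0 ^ 2
      - 2 * F (q 1) * p 0 * p 1 + E (q 1) * p 1 ^ 2) * mul_inv_cancel₀ (hd (q 1))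
  have hΦ1 : ∀ q ∈ U, ∀ p,
      M.form (X (M.cotangentMap β (q, p)).1) (M.cotangentMap β (q, p)).2 = p 0 := by
    intro q hq p
    rw [hcot q hq]
    simp only [hX q hq, form_add_right, form_smul_right, h00 q hq, h01 q hq]
    simp only [div_eq_mul_inv]
    linear_combination p 0 * mul_inv_cancel₀ (hd (q 1))
  have hUU : IsOpen (U ×ˢ (Set.univ : Set (Fin 2 → ℝ))) := hU.prod isOpen_univ
  let Φ : Fin 2 → M.Ambient × M.Ambient → ℝ :=
    ![fun y => 1 / 2 * M.form y.2 y.2, fun y => M.form (X y.1) y.2]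
  let Ψ : Fin 2 → (Fin 2 → ℝ) × (Fin 2 → ℝ) → ℝ :=
    ![ignorableHamiltonian E F G, fun x => x.2 0]
  have hΦ : ∀ k, Set.EqOn (Φ k ∘ M.cotangentMap β) (Ψ k) (U ×ˢ Set.univ) := by
    rintro k ⟨q, p⟩ ⟨hq, -⟩
    fin_cases k
    · exact hΦ0 q hq p
    · exact hΦ1 q hq p
  have hev : ∀ k, ∀ x ∈ U ×ˢ (Set.univ : Set (Fin 2 → ℝ)),
      Φ k ∘ M.cotangentMap β =ᶠ[nhds x] Ψ k := fun k x hx =>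
    (hΦ k).eventuallyEq_of_mem (hUU.mem_nhds hx)
  have hHev : ∀ x ∈ U ×ˢ (Set.univ : Set (Fin 2 → ℝ)), M.hamiltonian β =ᶠ[nhds x] Ψ 0 :=
    fun x hx => Filter.eventuallyEq_of_mem (hUU.mem_nhds hx) fun y hy => hH y.1 hy.1 y.2
  have hbr : ∀ k l x, poissonBracket (Ψ k) (Ψ l) x = 0 := by
    have h0 : ∀ x, poissonBracket (Ψ 0) (Ψ 1) x = 0 := fun x =>
      (poissonBracket_momentum _ 0 x).trans (fderiv_ignorableHamiltonian_coord hE hF hG hd x)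
    intro k l x
    fin_cases k <;> fin_cases l
    · exact poissonBracket_self _ x
    · exact h0 x
    · exact (poissonBracket_swap _ _ x).trans (neg_eq_zero.2 (h0 x))
    · exact poissonBracket_self _ x
  refine ⟨Φ, fun k => ?_, fun k x hx => ?_, fun k l x hx => ?_, ?_⟩
  · refine ContDiffOn.congr (ContDiff.contDiffOn ?_) (hΦ k)
    fin_cases k
    · exact contDiff_ignorableHamiltonian hE hF hG hd
    · change ContDiff ℝ ∞ fun x : (Fin 2 → ℝ) × (Fin 2 → ℝ) => x.2 0
      fun_prop
  · rw [poissonBracket_congr (hev k x hx) (hHev x hx), hbr]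
  · rw [poissonBracket_congr (hev k x hx) (hev l x hx), hbr]
  · filter_upwards [ae_mul_momentum_ne hE.continuous hF.continuous hE0] with x hx hxU
    rw [show (fun k => fderiv ℝ (Φ k ∘ M.cotangentMap β) x) = fun k => fderiv ℝ (Ψ k) x from
      funext fun k => (hev k x hxU).fderiv_eq]
    rw [Fintype.linearIndependent_iff]
    intro c hc
    rw [Fin.sum_univ_two] at hc
    -- `dp₀` vanishes on `∂/∂p₁`, where `dH` does not, and `dp₀ = 1` on `∂/∂p₀`
    have e1 := congrArg (fun L => L (0, Pi.single 1 1)) hc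
    have e0 := congrArg (fun L => L (0, Pi.single 0 1)) hc
    simp [Ψ, fderiv_momentum, fderiv_ignorableHamiltonian_momentum hE hF hG hd] at e1 e0
    have c0 : c 0 = 0 := e1.resolve_right (not_or.2 ⟨hx, hd _⟩)
    have c1 : c 1 = 0 := by simpa [c0] using e0
    intro i
    fin_cases i
    · exact c0
    · exact c1

end SpaceForm

/-! ### Integrability of the geodesic flow of the tube -/

theorem corollary1 (M : SpaceForm) (I : Set ℝ) (hI : IsOpen I) (hI' : I.OrdConnected)
    (hne : I.Nonempty) (γ T N B : ℝ → M.Ambient) (k₁ k₂ : ℝ → ℝ)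
    (hγ : M.IsFrenetCurve I γ T N B k₁ k₂)
    (hk₁ : ∀ s ∈ I, ∀ s' ∈ I, k₁ s = k₁ s') (hk₂ : ∀ s ∈ I, ∀ s' ∈ I, k₂ s = k₂ s')
    (f g : ℝ → ℝ) (hfg : IsSimpleClosedPlaneCurve f g) (ρ₀ : ℝ) (hρ₀ : 0 < ρ₀)
    (himm : ∀ q : Fin 2 → ℝ, q 0 ∈ I → LinearIndependent ℝ
      fun i => M.partialDeriv (M.generalizedTube γ N B f g ρ₀) i q) :
    (∀ s ∈ I, ∀ s' ∈ I, ∀ (ψ : ℝ) (p : Fin 2 → ℝ),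
      M.hamiltonian (M.generalizedTube γ N B f g ρ₀) (![s, ψ], p)
        = M.hamiltonian (M.generalizedTube γ N B f g ρ₀) (![s', ψ], p)) ∧
    M.LiouvilleIntegrable {q : Fin 2 → ℝ | q 0 ∈ I} (M.generalizedTube γ N B f g ρ₀) := by
  obtain ⟨s₀, hs₀⟩ := hne
  obtain ⟨P, Q, R, hP, hQ, hR, hP1, hβ⟩ := hγ.exists_generalizedTube_eq hfg ρ₀
  have hPd : Differentiable ℝ P := hP.differentiable (by simp)
  have hQd : Differentiable ℝ Q := hQ.differentiable (by simp)
  have hRd : Differentiable ℝ R := hR.differentiable (by simp)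
  generalize M.generalizedTube γ N B f g ρ₀ = β at *
  have hU : IsOpen {q : Fin 2 → ℝ | q 0 ∈ I} := hI.preimage (continuous_apply 0)
  have hpd := fun (q : Fin 2 → ℝ) (hq : q 0 ∈ I) =>
    hγ.partialDeriv_tube hI hPd hQd hRd (fun q hq => (hβ q hq).2) hq
  have hform := fun (q : Fin 2 → ℝ) (hq : q 0 ∈ I) =>
    hγ.form_partialDeriv_tube hI hPd hQd hRd hP1 (fun q hq => (hβ q hq).2) hq
  have htan : ∀ q : Fin 2 → ℝ, q 0 ∈ I → ∀ i, M.partialDeriv β i q ∈ M.tangent (β q) :=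
    fun q hq => M.partialDeriv_mem_tangent (hpd q hq).1
      ((hU.eventually_mem hq).mono fun x hx => (hβ x hx).1)
  have hP' : ContDiff ℝ ∞ (deriv P) := contDiff_infty_iff_deriv.1 hP |>.2
  have hQ' : ContDiff ℝ ∞ (deriv Q) := contDiff_infty_iff_deriv.1 hQ |>.2
  have hR' : ContDiff ℝ ∞ (deriv R) := contDiff_infty_iff_deriv.1 hR |>.2
  -- the coefficients are those of the first fundamental form, at the constant values of `k₁`,
  -- `k₂`
  have key := M.hamiltonian_eq_and_liouvilleIntegrable hU (β := β)
    (E := fun ψ => (P ψ - k₁ s₀ * Q ψ) ^ 2 + (k₂ s₀ * R ψ) ^ 2 + (k₂ s₀ * Q ψ) ^ 2)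
    (F := fun ψ => k₂ s₀ * (Q ψ * deriv R ψ - R ψ * deriv Q ψ))
    (G := fun ψ => M.curvature * deriv P ψ ^ 2 + deriv Q ψ ^ 2 + deriv R ψ ^ 2)
    (by fun_prop) (by fun_prop) (by fun_prop)
    (fun ψ h => ?_) (fun ψ h => ?_)
    (fun q hq => by rw [(hform q hq).1, hk₁ _ hq s₀ hs₀, hk₂ _ hq s₀ hs₀])
    (fun q hq => by rw [(hform q hq).2.1, hk₂ _ hq s₀ hs₀])
    (fun q hq => (hform q hq).2.2)
    (M.frenetField (γ s₀) (T s₀) (N s₀) (B s₀) (k₁ s₀) (k₂ s₀))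
    (fun q hq => by
      rw [hγ.frenetField_eq hI hI' hk₁ hk₂ hs₀ hq, (hβ q hq).2, (hpd q hq).2.1,
        hγ.frenetField_apply hI hq (hP1 _)])
  · refine ⟨fun s hs s' hs' ψ p => ?_, key.2⟩
    rw [key.1 _ (by simpa using hs), key.1 _ (by simpa using hs')]
    simp [ignorableHamiltonian]
  · have hq : (![s₀, ψ] : Fin 2 → ℝ) 0 ∈ I := hs₀
    exact (himm _ hq).ne_zero 0 (M.eq_zero_of_form_self (hβ _ hq).1 (htan _ hq 0)
      ((hform _ hq).1.trans h))
  · have hq : (![s₀, ψ] : Fin 2 → ℝ) 0 ∈ I := hs₀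
    have hli : LinearIndependent ℝ
        ![M.partialDeriv β 0 ![s₀, ψ], M.partialDeriv β 1 ![s₀, ψ]] := by
      convert himm _ hq using 1
      ext i
      fin_cases i <;> rfl
    refine M.gram_ne_zero (hβ _ hq).1 (htan _ hq 0) (htan _ hq 1) hli ?_
    rw [(hform _ hq).1, (hform _ hq).2.1, (hform _ hq).2.2]
    exact h
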